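/- Semigroups here are commutative with identity and are written additively. For a submonoid $M\subseteq\mathbb{Z}^n$ let $\mathbb{R}_{\ge 0}M\subseteq\mathbb{R}^n$ be the real cone generated by $M$; a cone is called pointed if it contains no line, i.e. no nonzero vector together with its negative. Let $A$ be a commutative domain. For a submonoid $M\subseteq\mathbb{Z}^n$, $A[M]$ denotes the $A$-subalgebra of $A[x_1^{\pm1},\dots,x_n^{\pm1}]$ generated by the monomials $x^t=x_1^{t_1}\cdots x_n^{t_n}$, $t\in M$. It is an affine semigroup ring if $M$ is finitely generated, and a pointed affine semigroup ring if moreover $\mathbb{R}_{\ge 0}M$ is pointed. Let $p$ be a prime number and $e_0=(1,0,\dots,0)\in\mathbb{Z}^{n+1}$. For a submonoid $M\subseteq\mathbb{Z}^{n+1}$ with $e_0\in M$, $\mathbb{Z}_{(p)}[\overline{M}]$ denotes the $\mathbb{Z}_{(p)}$-subalgebra of $\mathbb{Q}[x_1^{\pm1},\dots,x_n^{\pm1}]$ generated by the $p$-monomials $p^{t_0}x_1^{t_1}\cdots x_n^{t_n}$, $(t_0,\dots,t_n)\in M$. It is an affine $p$-semigroup ring if $M$ is finitely generated, and a pointed affine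 $p$-semigroup ring if moreover $\mathbb{R}_{\ge 0}M$ is pointed. Theorem. (1) Let $n\ge 0$, let $M\subseteq\mathbb{Z}^n$ be a finitely generated submonoid and let $b\in M$. Then there are a finitely generated submonoid $N\subseteq M$ with $b\in N$ and $\mathbb{R}_{\ge 0}N$ pointed, and an element $u\in N$, such that $M=N+\mathbb{Z}u$. (2) Every affine semigroup ring $R\subseteq A[x_1^{\pm1},\dots,x_n^{\pm1}]$ over a commutative domain $A$ is a localization of a pointed affine semigroup ring: there are a pointed affine semigroup ring $S\subseteq R$ over $A$ and a monomial $f\in S$ such that $R=S[1/f]$. (3) Every affine $p$-semigroup ring $R\subseteq\mathbb{Q}[x_1^{\pm1},\dots,x_n^{\pm1}]$ is a localization of a pointed affine $p$-semigroup ring: there are a pointed affine $p$-semigroup ring $S\subseteq R$ and a $p$-monomial $f\in S$ such that $R=S[1/f]$. -/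

import Mathlib

/-- The real cone `ℝ≥0 M ⊆ ℝⁿ` generated by a subset `M ⊆ ℤⁿ`. -/
noncomputable def realCone {n : ℕ} (M : Set (Fin n → ℤ)) : PointedCone ℝ (Fin n → ℝ) :=
  PointedCone.hull ℝ ((fun t : Fin n → ℤ => fun i => (t i : ℝ)) '' M)

/-- The cone `ℝ≥0 M` is pointed in the sense of polyhedral geometry: it contains no line, that is,
no nonzero vector together with its negative.  (Mathlib calls such a cone salient; its own
`ConvexCone.Pointed` only says that the cone contains `0`.) -/
def HasPointedCone {n : ℕ} (M : AddSubmonoid (Fin n → ℤ)) : Prop :=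
  (realCone (M : Set (Fin n → ℤ))).toConvexCone.Salient

/-- The Laurent polynomial ring `A[x₁^{±1}, …, xₙ^{±1}]`. -/
abbrev LaurentRing (A : Type*) [CommRing A] (n : ℕ) : Type _ :=
  AddMonoidAlgebra A (Fin n → ℤ)

/-- The monomial `x^t = x₁^{t₁} ⋯ xₙ^{tₙ}`. -/
noncomputable def laurentMonomial (A : Type*) [CommRing A] {n : ℕ} (t : Fin n → ℤ) :
    LaurentRing A n :=
  AddMonoidAlgebra.single t 1

/-- The semigroup ring `A[M]`: the `A`-subalgebra of the Laurent polynomial ring generated by the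
monomials `x^t` with `t ∈ M`. -/
noncomputable def semigroupRing (A : Type*) [CommRing A] {n : ℕ} (M : AddSubmonoid (Fin n → ℤ)) :
    Subalgebra A (LaurentRing A n) :=
  Algebra.adjoin A (laurentMonomial A '' (M : Set (Fin n → ℤ)))

/-- Affine semigroup rings: `R = A[M]` with `M` finitely generated. -/
def IsAffineSemigroupRing {A : Type*} [CommRing A] {n : ℕ}
    (R : Subalgebra A (LaurentRing A n)) : Prop :=
  ∃ M : AddSubmonoid (Fin n → ℤ), M.FG ∧ R = semigroupRing A M

/-- Pointed affine semigroup rings: `R = A[M]` with `M` finitely generated and `ℝ≥0 M` pointed. -/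
def IsPointedAffineSemigroupRing {A : Type*} [CommRing A] {n : ℕ}
    (R : Subalgebra A (LaurentRing A n)) : Prop :=
  ∃ M : AddSubmonoid (Fin n → ℤ), M.FG ∧ HasPointedCone M ∧ R = semigroupRing A M

/-- The ring `ℤ_(p)` of rational numbers whose reduced denominator is prime to `p`. -/
def zLocalizedAt (p : ℕ) : Subring ℚ where
  carrier := {q | q.den.Coprime p}
  mul_mem' {a b} ha hb := (Nat.Coprime.mul_left ha hb).coprime_dvd_left (Rat.mul_den_dvd a b)
  one_mem' := by simp
  add_mem' {a b} ha hb := (Nat.Coprime.mul_left ha hb).coprime_dvd_left (Rat.add_den_dvd a b)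
  zero_mem' := by simp
  neg_mem' {a} ha := by simpa using ha

/-- The `p`-monomial `p^{t₀} x₁^{t₁} ⋯ xₙ^{tₙ}` in `ℚ[x₁^{±1}, …, xₙ^{±1}]`. -/
noncomputable def pMonomial (p : ℕ) {n : ℕ} (t : Fin (n + 1) → ℤ) : LaurentRing ℚ n :=
  AddMonoidAlgebra.single (Fin.tail t) ((p : ℚ) ^ t 0)

/-- The `ℤ_(p)`-subalgebra of `ℚ[x₁^{±1}, …, xₙ^{±1}]` generated by the `p`-monomials with exponent
vector in `M ⊆ ℤ^{n+1}`. -/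
noncomputable def pSemigroupRing (p : ℕ) {n : ℕ} (M : AddSubmonoid (Fin (n + 1) → ℤ)) :
    Subalgebra (zLocalizedAt p) (LaurentRing ℚ n) :=
  Algebra.adjoin (zLocalizedAt p) (pMonomial p '' (M : Set (Fin (n + 1) → ℤ)))

/-- The standard basis vector `e₀` of `ℤ^{n+1}`, the exponent vector of `p`. -/
def expVecP (n : ℕ) : Fin (n + 1) → ℤ := Pi.single 0 1

/-- Affine `p`-semigroup rings: generated by the `p`-monomials with exponent vector in `M`, where
`M ⊆ ℤ^{n+1}` is finitely generated and contains `e₀`. -/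
def IsAffinePSemigroupRing (p : ℕ) {n : ℕ}
    (R : Subalgebra (zLocalizedAt p) (LaurentRing ℚ n)) : Prop :=
  ∃ M : AddSubmonoid (Fin (n + 1) → ℤ), M.FG ∧ expVecP n ∈ M ∧ R = pSemigroupRing p M

/-- Pointed affine `p`-semigroup rings: as before, with `ℝ≥0 M` pointed. -/
def IsPointedAffinePSemigroupRing (p : ℕ) {n : ℕ}
    (R : Subalgebra (zLocalizedAt p) (LaurentRing ℚ n)) : Prop :=
  ∃ M : AddSubmonoid (Fin (n + 1) → ℤ),
    M.FG ∧ expVecP n ∈ M ∧ HasPointedCone M ∧ R = pSemigroupRing p M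

/-- For subalgebras `S` and `R` of `T` and `f : T`: one has `S ⊆ R` and `f ∈ S`, and the inclusion
`S → R` exhibits `R` as the localization `S[1/f]`. -/
def IsLocalizationAwayOf {K T : Type*} [CommRing K] [CommRing T] [Algebra K T]
    (S R : Subalgebra K T) (f : T) : Prop :=
  ∃ (hSR : S ≤ R) (hf : f ∈ S),
    @IsLocalization.Away S _ (⟨f, hf⟩ : S) R _ (Subalgebra.inclusion hSR).toRingHom.toAlgebra

/-!
Let `U` be the group of units of `M`, and suppose that `U ≠ 0` (otherwise `N = M` and `u = 0` work).
Choose a nonzero `w ∈ U`, equal to `b` if `b` is itself a nonzero unit, and a signed coordinate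
function `ψ : ℤⁿ → ℤ` with `ψ w > 0`.  Given a finite set of generators of `M` that contains `b`,
replace each unit `g` among them by `g + c w`, with `c` so large that `ψ (g + c w) > 0`.  The
submonoid `N` generated by `w` and the new generators satisfies `M = N + ℤw`.  It has no nonzero
units: if a sum of generators is a unit of `M` then so is every summand, and `ψ` is positive on
all the generators of `N` that lie in `U`, hence on all nonzero elements of `N ∩ U`.

A submonoid of `ℤⁿ` without nonzero units generates a cone without lines
(`hasPointedCone_of_units_eq_zero`).  The point is that a relation `∑ aᵢ gᵢ = 0` with real
coefficients `aᵢ ≥ 0` between integer vectors can be replaced by one with natural coefficients `pᵢ`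
that is positive wherever the `aᵢ` are.  By simultaneous Diophantine approximation there is a
multiple `q a` with `q ≥ 1` that is very close to an integer vector `p`; then `∑ pᵢ gᵢ` is an integer
vector with entries of absolute value less than `1`, so it vanishes.

The statements on rings follow by applying the statement on monoids with `b = 0` and `b = e₀`,
respectively: in `R` the monomial of exponent `u` is invertible, and it carries every element of `R`
into `S` after multiplication by a high power (`isLocalizationAwayOf_adjoin`).
-/

/-! ### From real to natural relations between integer vectors -/

/-- Simultaneous Diophantine approximation, without a bound on the denominator. -/
theorem exists_nat_mul_near_int {ι : Type*} [Finite ι] (a : ι → ℝ) {δ : ℝ} (hδ : 0 < δ) :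
    ∃ q : ℕ, 0 < q ∧ ∃ p : ι → ℤ, ∀ i, |(p i : ℝ) - q * a i| < δ := by
  obtain ⟨Q, hQ⟩ := exists_nat_gt (1 / δ)
  have hQ0 : (0 : ℝ) < Q := lt_trans (by positivity) hQ
  have hQδ : 1 / (Q : ℝ) < δ := (one_div_lt hδ hQ0).1 hQ
  have hlt : ∀ (m : ℕ) (i : ι), ⌊Int.fract (m * a i) * Q⌋₊ < Q := fun m i => by
    rw [Nat.floor_lt (mul_nonneg (Int.fract_nonneg _) hQ0.le)]
    nlinarith [Int.fract_lt_one (m * a i)]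
  -- Pigeonhole: two multiples of `a` have their fractional parts in the same box of side `1 / Q`.
  obtain ⟨x, y, hxy, hf⟩ := Finite.exists_ne_map_eq_of_infinite
    (fun (m : ℕ) (i : ι) => (⟨_, hlt m i⟩ : Fin Q))
  wlog hlt' : x < y generalizing x y
  · exact this y x hxy.symm hf.symm (by omega)
  refine ⟨y - x, by omega, fun i => ⌊y * a i⌋ - ⌊x * a i⌋, fun i => lt_of_le_of_lt ?_ hQδ⟩
  have h1 : ⌊Int.fract (x * a i) * Q⌋₊ = ⌊Int.fract (y * a i) * Q⌋₊ := by
    simpa using congrArg Fin.val (congrFun hf i)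
  have hx := Nat.floor_le (mul_nonneg (Int.fract_nonneg (x * a i)) hQ0.le)
  have hy := Nat.floor_le (mul_nonneg (Int.fract_nonneg (y * a i)) hQ0.le)
  have hx' := Nat.lt_floor_add_one (Int.fract (x * a i) * Q)
  have hy' := Nat.lt_floor_add_one (Int.fract (y * a i) * Q)
  rw [h1] at hx hx'
  have h2 : |Int.fract (x * a i) - Int.fract (y * a i)| * Q ≤ 1 := by
    calc _ = |(Int.fract (x * a i) - Int.fract (y * a i)) * Q| := by rw [abs_mul, abs_of_pos hQ0]
      _ ≤ 1 := by
        rw [abs_le, sub_mul]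
        constructor <;> linarith
  have h3 : ((⌊y * a i⌋ - ⌊x * a i⌋ : ℤ) : ℝ) - ((y - x : ℕ) : ℝ) * a i
      = Int.fract (x * a i) - Int.fract (y * a i) := by
    rw [Nat.cast_sub hlt'.le]
    push_cast
    simp only [Int.fract]
    ring
  rw [h3]
  exact (le_div_iff₀ hQ0).2 h2

/-- A real relation with nonnegative coefficients between integer vectors yields one with natural
coefficients that are positive wherever the real ones are. -/
theorem exists_nat_relation {ι : Type*} [Fintype ι] {n : ℕ} (g : ι → Fin n → ℤ) (a : ι → ℝ)
    (ha : ∀ i, 0 ≤ a i) (h : ∀ k, ∑ i, a i * (g i k : ℝ) = 0) :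
    ∃ p : ι → ℕ, (∀ i, 0 < a i → 0 < p i) ∧ ∑ i, p i • g i = 0 := by
  -- The three bounds on `δ` make the `p i` nonnegative, make them positive where `a i` is, and force
  -- the entries of `∑ i, p i • g i` below `1` in absolute value.
  obtain ⟨δ, hδ0, hδ1, hδa, hδg⟩ : ∃ δ : ℝ, 0 < δ ∧ δ < 1 ∧ (∀ i, 0 < a i → δ < a i) ∧
      ∀ k, δ * ∑ i, |(g i k : ℝ)| < 1 := by
    have e0 : ∀ᶠ δ : ℝ in nhdsWithin 0 (Set.Ioi 0), 0 < δ := self_mem_nhdsWithin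
    have e1 : ∀ c : ℝ, 0 < c → ∀ᶠ δ : ℝ in nhdsWithin 0 (Set.Ioi 0), δ < c := fun c hc =>
      mem_nhdsWithin_of_mem_nhds (Iio_mem_nhds hc)
    have e2 : ∀ᶠ δ : ℝ in nhdsWithin 0 (Set.Ioi 0), ∀ i, 0 < a i → δ < a i := by
      refine Filter.eventually_all.2 fun i => ?_
      by_cases hi : 0 < a i
      · filter_upwards [e1 _ hi] with δ hδ _ using hδ
      · exact Filter.Eventually.of_forall fun δ h => absurd h hi
    have e3 : ∀ᶠ δ : ℝ in nhdsWithin 0 (Set.Ioi 0), ∀ k, δ * ∑ i, |(g i k : ℝ)| < 1 := by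
      refine Filter.eventually_all.2 fun k => ?_
      have hc : ContinuousAt (fun δ : ℝ => δ * ∑ i, |(g i k : ℝ)|) 0 := by fun_prop
      exact mem_nhdsWithin_of_mem_nhds (hc.eventually_lt continuousAt_const (by simp))
    obtain ⟨δ, h0, h1, h2, h3⟩ := (e0.and ((e1 1 one_pos).and (e2.and e3))).exists
    exact ⟨δ, h0, h1, h2, h3⟩
  obtain ⟨q, hq, p, hp⟩ := exists_nat_mul_near_int a hδ0
  have hq1 : (1 : ℝ) ≤ q := by exact_mod_cast hq
  have hp0 : ∀ i, 0 ≤ p i := fun i => by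
    have h1 := (abs_lt.1 (hp i)).1
    have h2 : (0 : ℝ) ≤ q * a i := mul_nonneg (by positivity) (ha i)
    have h3 : (-1 : ℝ) < p i := by linarith
    have h4 : (-1 : ℤ) < p i := by exact_mod_cast h3
    omega
  refine ⟨fun i => (p i).toNat, fun i hi => ?_, ?_⟩
  · have h1 := (abs_lt.1 (hp i)).1
    have h2 := hδa i hi
    have h3 : (0 : ℝ) < p i := by nlinarith
    exact Int.pos_iff_toNat_pos.1 (by exact_mod_cast h3)
  · ext k
    have h1 : ∑ i, (p i : ℝ) * g i k = ∑ i, ((p i : ℝ) - q * a i) * g i k := by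
      simp only [sub_mul, Finset.sum_sub_distrib, mul_assoc, ← Finset.mul_sum, h k]
      ring
    have h2 : |∑ i, (p i : ℝ) * g i k| < 1 := by
      rw [h1]
      refine lt_of_le_of_lt ((Finset.abs_sum_le_sum_abs _ _).trans ?_) (hδg k)
      rw [Finset.mul_sum]
      refine Finset.sum_le_sum fun i _ => ?_
      rw [abs_mul]
      exact mul_le_mul_of_nonneg_right (hp i).le (abs_nonneg _)
    have h3 : |∑ i, p i * g i k| < 1 := by exact_mod_cast h2
    have h4 := Int.abs_lt_one_iff.1 h3
    simpa [Finset.sum_apply, hp0] using h4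

/-! ### Pointed cones and the units of a monoid -/

theorem hasPointedCone_of_units_eq_zero {n : ℕ} (N : AddSubmonoid (Fin n → ℤ))
    (hN : ∀ x ∈ N, -x ∈ N → x = 0) : HasPointedCone N := by
  intro v hv hv0 hv'
  apply hv0
  change v ∈ realCone _ at hv
  change -v ∈ realCone _ at hv'
  rw [realCone, PointedCone.hull, Finsupp.mem_span_image_iff_linearCombination] at hv hv'
  obtain ⟨l, hl, hlv⟩ := hv
  obtain ⟨m, hm, hmv⟩ := hv'
  classical
  set s := l.support ∪ m.support with hs
  have hsN : ∀ x ∈ s, x ∈ N := fun x hx => by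
    rcases Finset.mem_union.1 hx with hx | hx
    · exact (Finsupp.mem_supported _ l).1 hl hx
    · exact (Finsupp.mem_supported _ m).1 hm hx
  have hlk : ∀ k, ∑ x ∈ s, (l x : ℝ) * (x k : ℝ) = v k := fun k => by
    rw [← hlv, Finsupp.linearCombination_apply, Finsupp.sum_of_support_subset l
      Finset.subset_union_left _ (by simp), Finset.sum_apply]
    rfl
  have hmk : ∀ k, ∑ x ∈ s, (m x : ℝ) * (x k : ℝ) = -v k := fun k => by
    rw [← Pi.neg_apply, ← hmv, Finsupp.linearCombination_apply, Finsupp.sum_of_support_subset m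
      Finset.subset_union_right _ (by simp), Finset.sum_apply]
    rfl
  obtain ⟨p, hp, hp0⟩ := exists_nat_relation (fun i : s => (i : Fin n → ℤ))
    (fun i => (l i : ℝ) + (m i : ℝ)) (fun i => add_nonneg (l i).2 (m i).2) (fun k => by
      rw [Finset.sum_coe_sort s (fun x => ((l x : ℝ) + (m x : ℝ)) * (x k : ℝ))]
      simp only [add_mul, Finset.sum_add_distrib, hlk, hmk]
      ring)
  have hzero : ∀ i : s, 0 < (l i : ℝ) → (i : Fin n → ℤ) = 0 := fun i hi => by
    have hpi := hp i (add_pos_of_pos_of_nonneg hi (m i).2)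
    refine hN _ (hsN _ i.2) ?_
    -- The relation expresses `-i` as a sum of elements of `N`, because `i` occurs in it.
    rw [← Finset.add_sum_erase _ _ (Finset.mem_univ i)] at hp0
    obtain ⟨c, hc⟩ : ∃ c, p i = c + 1 := ⟨p i - 1, by omega⟩
    have h1 : -(i : Fin n → ℤ) = c • (i : Fin n → ℤ) +
        ∑ j ∈ Finset.univ.erase i, p j • (j : Fin n → ℤ) := by
      rw [hc, succ_nsmul] at hp0
      rw [neg_eq_iff_add_eq_zero, ← hp0]
      abel
    rw [h1]
    exact N.add_mem (N.nsmul_mem (hsN _ i.2) _)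
      (N.sum_mem fun j _ => N.nsmul_mem (hsN _ j.2) _)
  ext k
  rw [← hlk k]
  refine Finset.sum_eq_zero fun x hx => ?_
  rcases (l x).2.eq_or_lt with h | h
  · rw [← h, zero_mul]
  · have := hzero ⟨x, hx⟩ h
    simp only at this
    simp [this]

/-! ### Splitting off a unit -/

theorem exists_pointed_add_zmultiples {n : ℕ} (M : AddSubmonoid (Fin n → ℤ)) (hM : M.FG)
    (b : Fin n → ℤ) (hb : b ∈ M) :
    ∃ N : AddSubmonoid (Fin n → ℤ), N ≤ M ∧ N.FG ∧ HasPointedCone N ∧ b ∈ N ∧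
      ∃ u ∈ N, ∀ x : Fin n → ℤ, x ∈ M ↔ ∃ y ∈ N, ∃ z : ℤ, x = y + z • u := by
  classical
  by_cases hU : ∀ x ∈ M, -x ∈ M → x = 0
  · exact ⟨M, le_rfl, hM, hasPointedCone_of_units_eq_zero M hU, hb, 0, M.zero_mem,
      fun x => ⟨fun hx => ⟨x, hx, 0, by simp⟩, by rintro ⟨y, hy, z, rfl⟩; simpa using hy⟩⟩
  obtain ⟨w, hwM, hwM', hw0, hwb⟩ : ∃ w ∈ M, -w ∈ M ∧ w ≠ 0 ∧ (-b ∈ M → b ≠ 0 → w = b) := by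
    by_cases h : -b ∈ M ∧ b ≠ 0
    · exact ⟨b, hb, h.1, h.2, fun _ _ => rfl⟩
    · push Not at hU
      obtain ⟨w, h1, h2, h3⟩ := hU
      exact ⟨w, h1, h2, h3, fun h4 h5 => absurd ⟨h4, h5⟩ h⟩
  obtain ⟨ψ, hψ⟩ : ∃ ψ : (Fin n → ℤ) →+ ℤ, 0 < ψ w := by
    obtain ⟨k, hk⟩ := Function.ne_iff.1 hw0
    rcases lt_or_gt_of_ne hk with h | h
    · exact ⟨-Pi.evalAddMonoidHom _ k, by simpa using h⟩
    · exact ⟨Pi.evalAddMonoidHom _ k, by simpa using h⟩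
  obtain ⟨s, hs⟩ := hM
  -- The coefficient `|ψ g| + 1` gives `ψ (f g) ≥ ψ g + |ψ g| + 1 > 0`.
  let f : (Fin n → ℤ) → (Fin n → ℤ) := fun g => if -g ∈ M then g + ((ψ g).natAbs + 1) • w else g
  have hsM : ∀ g ∈ insert b s, g ∈ M := fun g hg => by
    rcases Finset.mem_insert.1 hg with rfl | hg
    · exact hb
    · exact hs ▸ AddSubmonoid.subset_closure hg
  let t : Finset (Fin n → ℤ) := insert w ((insert b s).image f)
  let N := AddSubmonoid.closure (t : Set (Fin n → ℤ))
  have hwN : w ∈ N := AddSubmonoid.subset_closure (by simp [t])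
  have hfN : ∀ g ∈ insert b s, f g ∈ N := fun g hg =>
    AddSubmonoid.subset_closure (Finset.mem_insert_of_mem (Finset.mem_image_of_mem f hg))
  have htM : ∀ x ∈ t, x ∈ M := fun x hx => by
    rcases Finset.mem_insert.1 hx with rfl | hx
    · exact hwM
    · obtain ⟨g, hg, rfl⟩ := Finset.mem_image.1 hx
      simp only [f]
      split_ifs
      · exact M.add_mem (hsM g hg) (M.nsmul_mem hwM _)
      · exact hsM g hg
  have hNM : N ≤ M := AddSubmonoid.closure_le.2 htM
  have htψ : ∀ x ∈ t, -x ∈ M → 0 < ψ x := fun x hx hx' => by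
    rcases Finset.mem_insert.1 hx with rfl | hx
    · exact hψ
    · obtain ⟨g, hg, rfl⟩ := Finset.mem_image.1 hx
      by_cases h : -g ∈ M
      · simp only [f, if_pos h]
        rw [map_add, map_nsmul, nsmul_eq_mul]
        push_cast
        nlinarith [neg_abs_le (ψ g), abs_nonneg (ψ g)]
      · simp only [f, if_neg h] at hx'
        exact absurd hx' h
  -- If a sum of elements of `M` is a unit, so are its summands; hence positivity of `ψ` passes from
  -- the generators to all of `N ∩ U`.
  have hNψ : ∀ x ∈ N, -x ∈ M → x = 0 ∨ 0 < ψ x := fun x hx => by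
    induction hx using AddSubmonoid.closure_induction with
    | mem x hx => exact fun h => Or.inr (htψ x hx h)
    | zero => exact fun _ => Or.inl rfl
    | add x y hx hy ihx ihy =>
      intro h
      have h1 : -x ∈ M := by
        have := M.add_mem h (hNM hy)
        rwa [neg_add, neg_add_cancel_right] at this
      have h2 : -y ∈ M := by
        have := M.add_mem h (hNM hx)
        rwa [neg_add_rev, neg_add_cancel_right] at this
      rcases ihx h1 with rfl | h3
      · simpa using ihy h2
      · rcases ihy h2 with rfl | h4
        · simpa using Or.inr h3
        · exact Or.inr (by rw [map_add]; exact add_pos h3 h4)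
  refine ⟨N, hNM, ⟨t, rfl⟩, hasPointedCone_of_units_eq_zero N fun x hx hx' => ?_, ?_, w, hwN,
    fun x => ⟨fun hx => ?_, ?_⟩⟩
  · rcases hNψ x hx (hNM hx') with h | h
    · exact h
    · rcases hNψ (-x) hx' (by rw [neg_neg]; exact hNM hx) with h' | h'
      · exact neg_eq_zero.1 h'
      · rw [map_neg] at h'
        omega
  · by_cases h : -b ∈ M
    · by_cases h0 : b = 0
      · rw [h0]; exact N.zero_mem
      · rw [← hwb h h0]; exact hwN
    · have := hfN b (by simp)
      simpa only [f, if_neg h] using this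
  · rw [← hs] at hx
    induction hx using AddSubmonoid.closure_induction with
    | mem x hx =>
      refine ⟨f x, hfN x (Finset.mem_insert_of_mem hx), ?_⟩
      by_cases h : -x ∈ M
      · refine ⟨-(((ψ x).natAbs + 1 : ℕ) : ℤ), ?_⟩
        simp only [f, if_pos h, neg_smul, natCast_zsmul]
        abel
      · exact ⟨0, by simp [f, h]⟩
    | zero => exact ⟨0, N.zero_mem, 0, by simp⟩
    | add x y _ _ ihx ihy =>
      obtain ⟨x', hx', z, rfl⟩ := ihx
      obtain ⟨y', hy', z', rfl⟩ := ihy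
      exact ⟨x' + y', N.add_mem hx' hy', z + z', by rw [add_smul]; abel⟩
  · rintro ⟨y, hy, z, rfl⟩
    refine M.add_mem (hNM hy) ?_
    obtain ⟨k, rfl | rfl⟩ := z.eq_nat_or_neg
    · rw [natCast_zsmul]; exact M.nsmul_mem hwM k
    · rw [neg_smul, natCast_zsmul, ← smul_neg]; exact M.nsmul_mem hwM' k

/-! ### Localization of algebras generated by monomials -/

/-- If `f` is invertible in `K[X]` and a power of `f` carries each generator into `S`, then `K[X]` is
the localization of `S` at `f`. -/
theorem isLocalizationAwayOf_adjoin {K T : Type*} [CommRing K] [CommRing T] [Algebra K T]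
    (S : Subalgebra K T) (X : Set T) {f g : T} (hSX : S ≤ Algebra.adjoin K X) (hf : f ∈ S)
    (hg : g ∈ Algebra.adjoin K X) (hfg : f * g = 1) (hX : ∀ x ∈ X, ∃ k : ℕ, f ^ k * x ∈ S) :
    IsLocalizationAwayOf S (Algebra.adjoin K X) f := by
  have key : ∀ x ∈ Algebra.adjoin K X, ∃ k : ℕ, f ^ k * x ∈ S := fun x hx => by
    induction hx using Algebra.adjoin_induction with
    | mem x hx => exact hX x hx
    | algebraMap r => exact ⟨0, by simp⟩
    | add x y _ _ ihx ihy =>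
      obtain ⟨k, hk⟩ := ihx
      obtain ⟨l, hl⟩ := ihy
      refine ⟨k + l, ?_⟩
      have h : f ^ (k + l) * (x + y) = f ^ l * (f ^ k * x) + f ^ k * (f ^ l * y) := by ring
      rw [h]
      exact S.add_mem (S.mul_mem (S.pow_mem hf l) hk) (S.mul_mem (S.pow_mem hf k) hl)
    | mul x y _ _ ihx ihy =>
      obtain ⟨k, hk⟩ := ihx
      obtain ⟨l, hl⟩ := ihy
      refine ⟨k + l, ?_⟩
      have h : f ^ (k + l) * (x * y) = (f ^ k * x) * (f ^ l * y) := by ring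
      rw [h]
      exact S.mul_mem hk hl
  refine ⟨hSX, hf, ?_⟩
  let := (Subalgebra.inclusion hSX).toRingHom.toAlgebra
  have hmap : ∀ x : S, ((algebraMap S (Algebra.adjoin K X) x : Algebra.adjoin K X) : T) = x :=
    fun _ => rfl
  refine (isLocalization_iff _ _).2 ⟨?_, fun z => ?_, fun {x y} hxy => ⟨1, ?_⟩⟩
  · rintro ⟨_, k, rfl⟩
    rw [map_pow]
    exact (IsUnit.of_mul_eq_one (⟨g, hg⟩ : Algebra.adjoin K X) (Subtype.ext hfg)).pow k
  · obtain ⟨k, hk⟩ := key z z.2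
    refine ⟨(⟨_, hk⟩, ⟨_, k, rfl⟩), Subtype.ext ?_⟩
    simp [hmap, mul_comm]
  · have h := congrArg (Subtype.val) hxy
    rw [hmap, hmap] at h
    rw [Subtype.ext h]

/-- Criterion for monomials: if `χ` turns sums of exponents into products, then `M = N + ℤu` makes
`K[χ(M)]` the localization of `K[χ(N)]` at `χ(u)`. -/
theorem isLocalizationAwayOf_adjoin_image {K T E : Type*} [CommRing K] [CommRing T] [Algebra K T]
    [AddCommGroup E] (χ : Multiplicative E →* T) {N M : AddSubmonoid E} (hNM : N ≤ M) {u : E}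
    (hu : u ∈ N) (hM : ∀ x : E, x ∈ M ↔ ∃ y ∈ N, ∃ z : ℤ, x = y + z • u) :
    IsLocalizationAwayOf (Algebra.adjoin K ((fun x => χ (.ofAdd x)) '' (N : Set E)))
      (Algebra.adjoin K ((fun x => χ (.ofAdd x)) '' (M : Set E))) (χ (.ofAdd u)) := by
  have hu' : -u ∈ M := (hM _).2 ⟨0, N.zero_mem, -1, by simp⟩
  refine isLocalizationAwayOf_adjoin _ _ (Algebra.adjoin_mono (Set.image_mono hNM))
    (Algebra.subset_adjoin ⟨u, hu, rfl⟩) (g := χ (.ofAdd (-u)))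
    (Algebra.subset_adjoin ⟨-u, hu', rfl⟩) (by rw [← map_mul, ← ofAdd_add]; simp) ?_
  rintro _ ⟨x, hx, rfl⟩
  obtain ⟨y, hy, z, rfl⟩ := (hM x).1 hx
  refine ⟨z.natAbs, Algebra.subset_adjoin ⟨y + (z + z.natAbs).toNat • u,
    N.add_mem hy (N.nsmul_mem hu _), ?_⟩⟩
  -- Multiplying by `χ(u) ^ |z|` turns the exponent `y + z • u` into `y + (z + |z|) • u`, which is in `N`.
  have hz : 0 ≤ z + z.natAbs := by omega
  change χ _ = _
  rw [← map_pow, ← map_mul, ← ofAdd_nsmul, ← ofAdd_add, ← natCast_zsmul, Int.toNat_of_nonneg hz,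
    add_smul, natCast_zsmul]
  congr 2
  abel

/-- The character `t ↦ p^{t₀} x₁^{t₁} ⋯ xₙ^{tₙ}` of `ℤ^{n+1}`. -/
noncomputable def pMonomialHom {p : ℕ} (hp : p ≠ 0) (n : ℕ) :
    Multiplicative (Fin (n + 1) → ℤ) →* LaurentRing ℚ n where
  toFun t := pMonomial p t.toAdd
  map_one' := by
    simp only [pMonomial, toAdd_one, Pi.zero_apply, zpow_zero]
    rfl
  map_mul' s t := by
    have hp' : (p : ℚ) ≠ 0 := Nat.cast_ne_zero.2 hp
    simp only [pMonomial, toAdd_mul, AddMonoidAlgebra.single_mul_single, Pi.add_apply,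
      zpow_add₀ hp']
    rfl

theorem mainTheorem9 :
    (∀ (n : ℕ) (M : AddSubmonoid (Fin n → ℤ)), M.FG → ∀ b ∈ M,
      ∃ N : AddSubmonoid (Fin n → ℤ), N ≤ M ∧ N.FG ∧ HasPointedCone N ∧ b ∈ N ∧
        ∃ u ∈ N, ∀ x : Fin n → ℤ, x ∈ M ↔ ∃ y ∈ N, ∃ z : ℤ, x = y + z • u) ∧
    (∀ (A : Type*) [CommRing A] [IsDomain A] (n : ℕ) (R : Subalgebra A (LaurentRing A n)),
      IsAffineSemigroupRing R →
        ∃ S : Subalgebra A (LaurentRing A n), IsPointedAffineSemigroupRing S ∧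
          ∃ u : Fin n → ℤ, IsLocalizationAwayOf S R (laurentMonomial A u)) ∧
    (∀ (p : ℕ), p.Prime → ∀ (n : ℕ) (R : Subalgebra (zLocalizedAt p) (LaurentRing ℚ n)),
      IsAffinePSemigroupRing p R →
        ∃ S : Subalgebra (zLocalizedAt p) (LaurentRing ℚ n), IsPointedAffinePSemigroupRing p S ∧
          ∃ u : Fin (n + 1) → ℤ, IsLocalizationAwayOf S R (pMonomial p u)) := by
  refine ⟨fun n M hM b hb => exists_pointed_add_zmultiples M hM b hb, ?_, ?_⟩
  · rintro A _ _ n _ ⟨M, hM, rfl⟩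
    obtain ⟨N, hNM, hN, hNp, -, u, hu, h⟩ := exists_pointed_add_zmultiples M hM 0 M.zero_mem
    exact ⟨semigroupRing A N, ⟨N, hN, hNp, rfl⟩, u,
      isLocalizationAwayOf_adjoin_image (AddMonoidAlgebra.of A (Fin n → ℤ)) hNM hu h⟩
  · rintro p hp n _ ⟨M, hM, he, rfl⟩
    obtain ⟨N, hNM, hN, hNp, heN, u, hu, h⟩ := exists_pointed_add_zmultiples M hM _ he
    exact ⟨pSemigroupRing p N, ⟨N, hN, heN, hNp, rfl⟩, u,
      isLocalizationAwayOf_adjoin_image (pMonomialHom hp.ne_zero n) hNM hu h⟩
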